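/- A \emph{Čech closure operator} on a set $X$ is a map $c:\mathcal P(X)\to\mathcal P(X)$ with $c(\emptyset)=\emptyset$, $A\subseteq c(A)$ and $c(A\cup B)=c(A)\cup c(B)$; a \emph{neighborhood} of $x$ is a set $U$ with $x\notin c(X\setminus U)$, and a map $f:(X,c)\to(Y,d)$ is \emph{continuous} if $f(c(A))\subseteq d(f(A))$ for all $A\subseteq X$. The product of two closure spaces is the closure space in which the sets $U\times V$, with $U$ a neighborhood of $x$ and $V$ a neighborhood of $y$, form a neighborhood base at $(x,y)$. Let $I=[0,1]$ with the closure operator of its usual topology. For $x\in X$, the \emph{fundamental group} $\pi_1((X,c),x)$ is the set of continuous maps $v:I\to(X,c)$ with $v(0)=v(1)=x$, up to homotopy relative to $\{0,1\}$ through continuous maps $I\times I\to (X,c)$, with product $[v][w]=[v\star w]$ given by concatenation ($v$ first). For natural numbers $m,n$ with $n\ge 1$ let $c_{m,n}$ be the closure operator on $\mathbb Z_n=\mathbb Z/n\mathbb Z$ given by $$c_{m,n}(A)=\bigcup_{k\in A}\{k-m,\dots,k-1,k,k+1,\dots,k+m\}\bmod n .$$ \textbf{Statement.} Let $m,n$ be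 natural numbers with $3\le 3m<n$. Then, for every base point $x\in\mathbb Z_n$, there is a group isomorphism $$\pi_1\big((\mathbb Z_n,c_{m,n}),x\big)\cong\mathbb Z .$$ -/

import Mathlib

open Set Filter Topology
open scoped unitInterval

/-- A Čech closure operator on a set `X` (idempotence is not required). -/
structure CechClosure (X : Type*) where
  /-- the closure of a subset -/
  cl : Set X → Set X
  cl_empty : cl ∅ = ∅
  subset_cl : ∀ A, A ⊆ cl A
  cl_union : ∀ A B, cl (A ∪ B) = cl A ∪ cl B

namespace CechClosure

variable {X Y T : Type*}

theorem cl_mono (c : CechClosure X) {A B : Set X} (h : A ⊆ B) : c.cl A ⊆ c.cl B := by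
  have h1 := c.cl_union A B
  rw [union_eq_self_of_subset_left h] at h1
  rw [h1]
  exact subset_union_left

/-- `U` is a neighborhood of the point `x`: `x ∈ X - c (X - U)`. -/
def IsNhd (c : CechClosure X) (U : Set X) (x : X) : Prop := x ∈ (c.cl Uᶜ)ᶜ

/-- The neighborhood system of a point, as a filter. -/
def nhd (c : CechClosure X) (x : X) : Filter X where
  sets := {U | c.IsNhd U x}
  univ_sets := by simp [IsNhd, c.cl_empty]
  sets_of_superset := fun {U V} hU hUV hx =>
    hU (c.cl_mono (compl_subset_compl.2 hUV) hx)
  inter_sets := fun {U V} hU hV hx => by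
    rw [compl_inter, c.cl_union] at hx
    exact hx.elim hU hV

theorem mem_nhd {c : CechClosure X} {U : Set X} {x : X} : U ∈ c.nhd x ↔ c.IsNhd U x := Iff.rfl

theorem mem_cl_iff {c : CechClosure X} {A : Set X} {x : X} : x ∈ c.cl A ↔ Aᶜ ∉ c.nhd x := by
  simp [mem_nhd, IsNhd]

theorem mem_of_isNhd {c : CechClosure X} {U : Set X} {x : X} (h : c.IsNhd U x) : x ∈ U := by
  by_contra hx
  exact h (c.subset_cl _ hx)

/-- The closure structure of a topological space. -/
def ofTop (X : Type*) [TopologicalSpace X] : CechClosure X where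
  cl := fun A => closure A
  cl_empty := closure_empty
  subset_cl := fun _ => subset_closure
  cl_union := fun _ _ => closure_union

theorem nhd_ofTop [TopologicalSpace X] (x : X) : (ofTop X).nhd x = 𝓝 x := by
  ext U
  rw [mem_nhd, IsNhd, ofTop, ← interior_eq_compl_closure_compl, mem_interior_iff_mem_nhds]

/-- The product closure structure: the sets `U ×ˢ V`, with `U` a neighborhood of `x` and `V` a
neighborhood of `y`, are a local base at `(x, y)`. -/
def prod (c : CechClosure X) (d : CechClosure Y) : CechClosure (X × Y) where
  cl := fun A => {p | ∀ U V, c.IsNhd U p.1 → d.IsNhd V p.2 → ((U ×ˢ V) ∩ A).Nonempty}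
  cl_empty := by
    ext p
    simp only [inter_empty, Set.not_nonempty_empty, mem_ofPred_eq, mem_empty_iff_false, iff_false]
    intro h
    exact h univ univ (c.nhd p.1).univ_sets (d.nhd p.2).univ_sets
  subset_cl := fun A p hp U V hU hV => ⟨p, ⟨mem_of_isNhd hU, mem_of_isNhd hV⟩, hp⟩
  cl_union := fun A B => by
    ext p
    constructor
    · intro h
      by_contra hc
      simp only [mem_union, mem_ofPred_eq, not_or, not_forall] at hc
      obtain ⟨⟨U, V, hU, hV, hA⟩, ⟨U', V', hU', hV', hB⟩⟩ := hc
      obtain ⟨q, ⟨⟨hq1, hq1'⟩, ⟨hq2, hq2'⟩⟩, hq⟩ := h (U ∩ U') (V ∩ V')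
        ((c.nhd p.1).inter_sets hU hU') ((d.nhd p.2).inter_sets hV hV')
      rcases hq with hq | hq
      · exact hA ⟨q, ⟨hq1, hq2⟩, hq⟩
      · exact hB ⟨q, ⟨hq1', hq2'⟩, hq⟩
    · rintro (h | h) U V hU hV
      · exact (h U V hU hV).mono (inter_subset_inter_right _ subset_union_left)
      · exact (h U V hU hV).mono (inter_subset_inter_right _ subset_union_right)

theorem nhd_prod (c : CechClosure X) (d : CechClosure Y) (p : X × Y) :
    (c.prod d).nhd p = c.nhd p.1 ×ˢ d.nhd p.2 := by
  ext W
  rw [mem_nhd, IsNhd, mem_prod_iff]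
  constructor
  · intro h
    simp only [prod, mem_compl_iff, mem_ofPred_eq, not_forall] at h
    obtain ⟨U, V, hU, hV, h⟩ := h
    refine ⟨U, hU, V, hV, fun q hq => ?_⟩
    by_contra hW
    exact h ⟨q, hq, hW⟩
  · rintro ⟨U, hU, V, hV, h⟩ hp
    obtain ⟨q, hq, hW⟩ := hp U V hU hV
    exact hW (h hq)

/-- Continuity of a map of closure spaces: `f (c U) ⊆ d (f U)` for every subset `U`. -/
def Cont (c : CechClosure X) (d : CechClosure Y) (f : X → Y) : Prop :=
  ∀ U : Set X, f '' c.cl U ⊆ d.cl (f '' U)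

theorem cont_iff {c : CechClosure X} {d : CechClosure Y} {f : X → Y} :
    Cont c d f ↔ ∀ x, Tendsto f (c.nhd x) (d.nhd (f x)) := by
  constructor
  · intro h x V hV hx
    refine hV (d.cl_mono ?_ (h _ (mem_image_of_mem f hx)))
    rintro _ ⟨y, hy, rfl⟩
    exact hy
  · rintro h U _ ⟨x, hx, rfl⟩
    rw [mem_cl_iff] at hx ⊢
    intro hV
    refine hx (mem_of_superset (h x hV) ?_)
    intro y hy hyU
    exact hy (mem_image_of_mem f hyU)

theorem cont_ofTop_iff [TopologicalSpace T] {c : CechClosure X} {f : T → X} :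
    Cont (ofTop T) c f ↔ ∀ t, Tendsto f (𝓝 t) (c.nhd (f t)) := by
  simp only [cont_iff, nhd_ofTop]

theorem cont_square_iff {c : CechClosure X} {f : I × I → X} :
    Cont ((ofTop I).prod (ofTop I)) c f ↔ Cont (ofTop (I × I)) c f := by
  rw [cont_iff, cont_iff]
  refine forall_congr' fun p => ?_
  rw [nhd_prod, nhd_ofTop, nhd_ofTop, nhd_ofTop, ← nhds_prod_eq]

theorem cont_const [TopologicalSpace T] (c : CechClosure X) (x : X) :
    Cont (ofTop T) c (fun _ : T => x) := by
  rw [cont_ofTop_iff]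
  intro t U hU
  have hx : x ∈ U := mem_of_isNhd hU
  exact Filter.mem_map.2 (Filter.Eventually.of_forall fun _ => hx)

theorem Cont.comp_continuous {S : Type*} [TopologicalSpace S] [TopologicalSpace T]
    {c : CechClosure X} {f : T → X} (hf : Cont (ofTop T) c f) {φ : S → T} (hφ : Continuous φ) :
    Cont (ofTop S) c (fun s => f (φ s)) := by
  rw [cont_ofTop_iff] at hf ⊢
  exact fun s => (hf (φ s)).comp hφ.continuousAt

/-- Gluing two continuous maps along a continuous real function. -/
theorem Cont.glue [TopologicalSpace T] {c : CechClosure X} {f g : T → X}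
    (hf : Cont (ofTop T) c f) (hg : Cont (ofTop T) c g) {u : T → ℝ} (hu : Continuous u)
    (h : ∀ t, u t = 1 / 2 → f t = g t) :
    Cont (ofTop T) c (fun t => if u t ≤ 1 / 2 then f t else g t) := by
  rw [cont_ofTop_iff] at hf hg ⊢
  intro t
  rcases lt_trichotomy (u t) (1 / 2) with ht | ht | ht
  · rw [if_pos ht.le]
    refine (hf t).congr' ?_
    filter_upwards [hu.continuousAt.eventually (gt_mem_nhds ht)] with s hs
    rw [if_pos (le_of_lt hs)]
  · rw [if_pos ht.le]
    intro V hV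
    have h1 : ∀ᶠ s in 𝓝 t, f s ∈ V := hf t hV
    have h2 : ∀ᶠ s in 𝓝 t, g s ∈ V := hg t (by rwa [← h t ht])
    refine (h1.and h2).mono fun s hs => ?_
    change (if u s ≤ 1 / 2 then f s else g s) ∈ V
    split_ifs
    · exact hs.1
    · exact hs.2
  · rw [if_neg (not_le.2 ht)]
    refine (hg t).congr' ?_
    filter_upwards [hu.continuousAt.eventually (lt_mem_nhds ht)] with s hs
    rw [if_neg (not_le.2 hs)]

/-- `f` is homotopic to `g` rel `S`, as maps of closure spaces. -/
def HomotopicRel (c : CechClosure X) (d : CechClosure Y) (S : Set X) (f g : X → Y) : Prop :=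
  ∃ H : X × I → Y, Cont (c.prod (ofTop I)) d H ∧
    (∀ x, H (x, 0) = f x) ∧ (∀ x, H (x, 1) = g x) ∧
    ∀ x ∈ S, ∀ t, H (x, t) = f x ∧ H (x, t) = g x

/-- A loop at `x`: a continuous map of pairs from `(I, ∂I)` to `(X, {x})`. -/
structure Loop (c : CechClosure X) (x : X) where
  toFun : I → X
  cont : Cont (ofTop I) c toFun
  source : toFun 0 = x
  target : toFun 1 = x

/-- The point `2 t` of the interval, truncated. -/
noncomputable def firstHalf (t : I) : I := projIcc 0 1 zero_le_one (2 * (t : ℝ))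

/-- The point `2 t - 1` of the interval, truncated. -/
noncomputable def secondHalf (t : I) : I := projIcc 0 1 zero_le_one (2 * (t : ℝ) - 1)

theorem continuous_firstHalf : Continuous firstHalf := by
  unfold firstHalf
  exact continuous_projIcc.comp (by fun_prop)

theorem continuous_secondHalf : Continuous secondHalf := by
  unfold secondHalf
  exact continuous_projIcc.comp (by fun_prop)

theorem firstHalf_of_ge {t : I} (h : 1 / 2 ≤ (t : ℝ)) : firstHalf t = 1 :=
  projIcc_of_right_le _ (by linarith)

theorem secondHalf_of_le {t : I} (h : (t : ℝ) ≤ 1 / 2) : secondHalf t = 0 :=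
  projIcc_of_le_left _ (by linarith)

theorem coe_firstHalf {t : I} (h : (t : ℝ) ≤ 1 / 2) : (firstHalf t : ℝ) = 2 * t := by
  unfold firstHalf
  rw [projIcc_of_mem zero_le_one ⟨by linarith [t.2.1], by linarith⟩]

theorem coe_secondHalf {t : I} (h : 1 / 2 ≤ (t : ℝ)) : (secondHalf t : ℝ) = 2 * t - 1 := by
  unfold secondHalf
  rw [projIcc_of_mem zero_le_one ⟨by linarith, by linarith [t.2.2]⟩]

@[simp] theorem firstHalf_zero : firstHalf 0 = 0 := projIcc_of_le_left _ (by simp)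

@[simp] theorem secondHalf_one : secondHalf 1 = 1 := projIcc_of_right_le _ (by norm_num)

/-- The concatenation of two maps: `f (2 t)` for `t ≤ 1/2` and `g (2 t - 1)` for `t > 1/2`. -/
noncomputable def star (f g : I → X) (t : I) : X :=
  if (t : ℝ) ≤ 1 / 2 then f (firstHalf t) else g (secondHalf t)

theorem cont_star {c : CechClosure X} {f g : I → X} (hf : Cont (ofTop I) c f)
    (hg : Cont (ofTop I) c g) (h : f 1 = g 0) : Cont (ofTop I) c (star f g) := by
  refine Cont.glue (hf.comp_continuous continuous_firstHalf)
    (hg.comp_continuous continuous_secondHalf) continuous_subtype_val ?_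
  intro t ht
  rw [firstHalf_of_ge ht.ge, secondHalf_of_le ht.le, h]

@[simp] theorem star_zero (f g : I → X) : star f g 0 = f 0 := by simp [star]

@[simp] theorem star_one (f g : I → X) : star f g 1 = g 1 := by
  have h : ¬ ((1 : I) : ℝ) ≤ 1 / 2 := by norm_num
  rw [star, if_neg h, secondHalf_one]

namespace Loop

variable {c : CechClosure X} {x : X}

/-- The concatenation of two loops. -/
noncomputable def mul (v w : Loop c x) : Loop c x where
  toFun := star v.toFun w.toFun
  cont := cont_star v.cont w.cont (by rw [v.target, w.source])
  source := by rw [star_zero, v.source]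
  target := by rw [star_one, w.target]

/-- The constant loop. -/
def one (c : CechClosure X) (x : X) : Loop c x where
  toFun := fun _ => x
  cont := cont_const c x
  source := rfl
  target := rfl

/-- The reversed loop. -/
def inv (v : Loop c x) : Loop c x where
  toFun := fun t => v.toFun (σ t)
  cont := v.cont.comp_continuous unitInterval.continuous_symm
  source := by simp [v.target]
  target := by simp [v.source]

/-- Two loops are homotopic rel `∂I`. -/
def Homotopic (v w : Loop c x) : Prop := HomotopicRel (ofTop I) c {0, 1} v.toFun w.toFun

theorem homotopic_iff {v w : Loop c x} : v.Homotopic w ↔ ∃ H : I × I → X,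
    Cont (ofTop (I × I)) c H ∧ (∀ s, H (s, 0) = v.toFun s) ∧ (∀ s, H (s, 1) = w.toFun s) ∧
    ∀ t, H (0, t) = x ∧ H (1, t) = x := by
  unfold Homotopic HomotopicRel
  refine exists_congr fun H => ?_
  rw [cont_square_iff]
  simp [v.source, v.target, w.source, w.target, forall_and]

/-- A homotopy between two loops that factor through a loop. -/
theorem homotopic_of_factor (u v w : Loop c x) (φ ψ : I → I) (hφ : Continuous φ)
    (hψ : Continuous ψ) (hv : ∀ s, v.toFun s = u.toFun (φ s))
    (hw : ∀ s, w.toFun s = u.toFun (ψ s)) (h0 : φ 0 = ψ 0) (h1 : φ 1 = ψ 1) :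
    v.Homotopic w := by
  rw [homotopic_iff]
  have hmem : ∀ p : I × I, (1 - (p.2 : ℝ)) * φ p.1 + p.2 * ψ p.1 ∈ I := fun p =>
    convex_Icc (0 : ℝ) 1 (φ p.1).2 (ψ p.1).2 (by linarith [p.2.2.2]) p.2.2.1 (by ring)
  refine ⟨fun p => u.toFun ⟨(1 - (p.2 : ℝ)) * φ p.1 + p.2 * ψ p.1, hmem p⟩, ?_, ?_, ?_, ?_⟩
  · exact u.cont.comp_continuous (Continuous.subtype_mk (by fun_prop) _)
  · intro s
    rw [hv]
    exact congrArg u.toFun (Subtype.ext (by simp))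
  · intro s
    rw [hw]
    exact congrArg u.toFun (Subtype.ext (by simp))
  · intro t
    constructor
    · refine Eq.trans ?_ ((hv 0).symm.trans v.source)
      exact congrArg u.toFun (Subtype.ext (by simp only [← h0]; ring))
    · refine Eq.trans ?_ ((hv 1).symm.trans v.target)
      exact congrArg u.toFun (Subtype.ext (by simp only [← h1]; ring))

theorem Homotopic.refl (v : Loop c x) : v.Homotopic v :=
  homotopic_of_factor v v v id id continuous_id continuous_id (fun _ => rfl) (fun _ => rfl) rfl rfl

theorem Homotopic.symm {v w : Loop c x} (h : v.Homotopic w) : w.Homotopic v := by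
  rw [homotopic_iff] at h ⊢
  obtain ⟨H, hH, h0, h1, h2⟩ := h
  refine ⟨fun p => H (p.1, σ p.2), hH.comp_continuous (by fun_prop), ?_, ?_, fun t => h2 _⟩
  · simpa using h1
  · simpa using h0

theorem Homotopic.trans {u v w : Loop c x} (h : u.Homotopic v) (h' : v.Homotopic w) :
    u.Homotopic w := by
  rw [homotopic_iff] at h h' ⊢
  obtain ⟨H, hH, h0, h1, h2⟩ := h
  obtain ⟨K, hK, k0, k1, k2⟩ := h'
  refine ⟨fun p => star (fun t => H (p.1, t)) (fun t => K (p.1, t)) p.2, ?_, ?_, ?_, ?_⟩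
  · refine Cont.glue (T := I × I) (f := fun p => H (p.1, firstHalf p.2))
      (g := fun p => K (p.1, secondHalf p.2)) (u := fun p => (p.2 : ℝ))
      (hH.comp_continuous ?_) (hK.comp_continuous ?_) (by fun_prop) ?_
    · exact continuous_fst.prodMk (continuous_firstHalf.comp continuous_snd)
    · exact continuous_fst.prodMk (continuous_secondHalf.comp continuous_snd)
    · intro p hp
      rw [firstHalf_of_ge hp.ge, secondHalf_of_le hp.le, h1, k0]
  · intro s
    simp [h0]
  · intro s
    simp [k1]
  · intro t
    by_cases ht : (t : ℝ) ≤ 1 / 2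
    · simp only [star, if_pos ht]
      exact h2 _
    · simp only [star, if_neg ht]
      exact k2 _

theorem Homotopic.mul {v v' w w' : Loop c x} (h : v.Homotopic v') (h' : w.Homotopic w') :
    (v.mul w).Homotopic (v'.mul w') := by
  rw [homotopic_iff] at h h' ⊢
  obtain ⟨H, hH, h0, h1, h2⟩ := h
  obtain ⟨K, hK, k0, k1, k2⟩ := h'
  refine ⟨fun p => star (fun s => H (s, p.2)) (fun s => K (s, p.2)) p.1, ?_, ?_, ?_, ?_⟩
  · refine Cont.glue (T := I × I) (f := fun p => H (firstHalf p.1, p.2))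
      (g := fun p => K (secondHalf p.1, p.2)) (u := fun p => (p.1 : ℝ))
      (hH.comp_continuous ?_) (hK.comp_continuous ?_) (by fun_prop) ?_
    · exact (continuous_firstHalf.comp continuous_fst).prodMk continuous_snd
    · exact (continuous_secondHalf.comp continuous_fst).prodMk continuous_snd
    · intro p hp
      rw [firstHalf_of_ge hp.ge, secondHalf_of_le hp.le, (h2 _).2, (k2 _).1]
  · intro s
    simp [h0, k0, Loop.mul]
  · intro s
    simp [h1, k1, Loop.mul]
  · intro t
    simp [h2, k2]

theorem Homotopic.inv {v w : Loop c x} (h : v.Homotopic w) : v.inv.Homotopic w.inv := by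
  rw [homotopic_iff] at h ⊢
  obtain ⟨H, hH, h0, h1, h2⟩ := h
  refine ⟨fun p => H (σ p.1, p.2), hH.comp_continuous (by fun_prop), ?_, ?_, fun t => ?_⟩
  · simp [h0, Loop.inv]
  · simp [h1, Loop.inv]
  · simp [h2]

theorem one_mul_homotopic (v : Loop c x) : ((one c x).mul v).Homotopic v := by
  refine homotopic_of_factor v _ v secondHalf id continuous_secondHalf continuous_id ?_
    (fun _ => rfl) (secondHalf_of_le (by simp)) (by simp)
  intro s
  simp only [Loop.mul, star, one]
  split_ifs with h
  · rw [secondHalf_of_le h, v.source]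
  · rfl

theorem inv_mul_homotopic (v : Loop c x) : (v.inv.mul v).Homotopic (one c x) := by
  refine homotopic_of_factor v _ _
    (fun t => if (t : ℝ) ≤ 1 / 2 then σ (firstHalf t) else secondHalf t) (fun _ => 1)
    ?_ continuous_const ?_ (fun _ => v.target.symm) (by simp) ?_
  · refine Continuous.if_le (unitInterval.continuous_symm.comp continuous_firstHalf)
      continuous_secondHalf continuous_subtype_val continuous_const ?_
    intro t ht
    rw [firstHalf_of_ge ht.ge, secondHalf_of_le ht.le, unitInterval.symm_one]
  · intro s
    simp only [Loop.mul, star, Loop.inv]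
    split_ifs <;> rfl
  · have h : ¬ ((1 : I) : ℝ) ≤ 1 / 2 := by norm_num
    simp only [if_neg h, secondHalf_one]

theorem mul_one_homotopic (v : Loop c x) : (v.mul (one c x)).Homotopic v := by
  refine homotopic_of_factor v _ v firstHalf id continuous_firstHalf continuous_id ?_
    (fun _ => rfl) (by simp) (firstHalf_of_ge (by norm_num))
  intro s
  simp only [Loop.mul, star, one]
  split_ifs with h
  · rfl
  · rw [firstHalf_of_ge (not_le.1 h).le, v.target]

theorem mul_assoc_homotopic (u v w : Loop c x) :
    ((u.mul v).mul w).Homotopic (u.mul (v.mul w)) := by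
  have hmem : ∀ t : I, min (2 * (t : ℝ)) (min ((t : ℝ) + 1 / 4) (((t : ℝ) + 1) / 2)) ∈ I := by
    intro t
    have h0 := t.2.1
    have h1 := t.2.2
    exact ⟨le_min (by linarith) (le_min (by linarith) (by linarith)),
      (min_le_right _ _).trans ((min_le_right _ _).trans (by linarith))⟩
  refine homotopic_of_factor (u.mul (v.mul w)) _ _ (fun t => ⟨_, hmem t⟩) id
    (Continuous.subtype_mk (by fun_prop) _) continuous_id ?_ (fun _ => rfl)
    (Subtype.ext (by norm_num)) (Subtype.ext (by norm_num))
  intro t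
  have ht0 := t.2.1
  have ht1 := t.2.2
  simp only [Loop.mul, star]
  by_cases h : (t : ℝ) ≤ 1 / 2
  · rw [if_pos h]
    by_cases h' : (t : ℝ) ≤ 1 / 4
    · have e : min (2 * (t : ℝ)) (min ((t : ℝ) + 1 / 4) (((t : ℝ) + 1) / 2)) = 2 * t :=
        min_eq_left (le_min (by linarith) (by linarith))
      have e1 := coe_firstHalf h
      rw [if_pos (by linarith), if_pos (by rw [e]; linarith)]
      refine congrArg u.toFun (congrArg firstHalf (Subtype.ext ?_))
      exact e1.trans e.symm
    · push Not at h'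
      have e : min (2 * (t : ℝ)) (min ((t : ℝ) + 1 / 4) (((t : ℝ) + 1) / 2)) = t + 1 / 4 := by
        rw [min_eq_left (by linarith : (t : ℝ) + 1 / 4 ≤ ((t : ℝ) + 1) / 2),
          min_eq_right (by linarith)]
      have e1 := coe_firstHalf h
      have e2 : (secondHalf ⟨_, hmem t⟩ : ℝ) = 2 * (t + 1 / 4) - 1 := by
        rw [coe_secondHalf (by change 1 / 2 ≤ min _ _; rw [e]; linarith)]
        change 2 * min _ _ - 1 = _
        rw [e]
      rw [if_neg (by linarith), if_neg (by rw [e]; linarith), if_pos (by linarith)]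
      refine congrArg v.toFun (Subtype.ext ?_)
      rw [coe_secondHalf (by linarith), coe_firstHalf (t := secondHalf _) (by rw [e2]; linarith),
        e1, e2]
      ring
  · push Not at h
    have e : min (2 * (t : ℝ)) (min ((t : ℝ) + 1 / 4) (((t : ℝ) + 1) / 2)) = (t + 1) / 2 := by
      rw [min_eq_right (by linarith : ((t : ℝ) + 1) / 2 ≤ (t : ℝ) + 1 / 4),
        min_eq_right (by linarith)]
    have e2 : (secondHalf ⟨_, hmem t⟩ : ℝ) = t := by
      rw [coe_secondHalf (by change 1 / 2 ≤ min _ _; rw [e]; linarith)]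
      change 2 * min _ _ - 1 = _
      rw [e]
      ring
    rw [if_neg (by linarith), if_neg (by rw [e]; linarith), if_neg (by linarith)]
    refine congrArg w.toFun (congrArg secondHalf (Subtype.ext ?_))
    rw [e2]

/-- Homotopy rel `∂I`, as an equivalence relation on loops. -/
instance setoid (c : CechClosure X) (x : X) : Setoid (Loop c x) where
  r := Homotopic
  iseqv := ⟨Homotopic.refl, Homotopic.symm, Homotopic.trans⟩

end Loop

/-- The fundamental group of the closure space `(X, c)` at `x`: classes of loops at `x` up to
homotopy rel `∂I`. -/
def FundamentalGroup (c : CechClosure X) (x : X) : Type _ := Quotient (Loop.setoid c x)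

/-- The group structure: `[v] [w] = [v ⋆ w]`. -/
noncomputable instance instGroup (c : CechClosure X) (x : X) : Group (FundamentalGroup c x) where
  mul := Quotient.map₂ Loop.mul (fun _ _ h _ _ h' => Loop.Homotopic.mul h h')
  one := Quotient.mk _ (Loop.one c x)
  inv := Quotient.map Loop.inv (fun _ _ h => Loop.Homotopic.inv h)
  mul_assoc := by
    rintro ⟨u⟩ ⟨v⟩ ⟨w⟩
    exact Quotient.sound (Loop.mul_assoc_homotopic u v w)
  one_mul := by
    rintro ⟨v⟩
    exact Quotient.sound (Loop.one_mul_homotopic v)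
  mul_one := by
    rintro ⟨v⟩
    exact Quotient.sound (Loop.mul_one_homotopic v)
  inv_mul_cancel := by
    rintro ⟨v⟩
    exact Quotient.sound (Loop.inv_mul_homotopic v)

/-- The closure structure `c_{m,n}` on `ℤ/n`: `c(k)` is the image of `{k - m, …, k + m}` modulo
`n`, and `c(A)` is the union of the `c(k)` for `k ∈ A`. -/
def cyclic (m n : ℕ) : CechClosure (ZMod n) where
  cl := fun A => ⋃ k ∈ A, {y | ∃ j : ℤ, -(m : ℤ) ≤ j ∧ j ≤ m ∧ y = k + (j : ZMod n)}
  cl_empty := by simp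
  subset_cl := fun A k hk => by
    simp only [mem_iUnion]
    exact ⟨k, hk, 0, by simp, by simp, by simp⟩
  cl_union := fun A B => biUnion_union A B _

end CechClosure

/-! The map `k ↦ x + k` from `ℤ`, where the closure of `k` is `{k - m, …, k + m}`, to the cycle
plays the role of the universal cover `ℝ → S¹`. A map from a topological space into either space is
continuous exactly when near each point its value moves by at most `m`.

Lifts exist locally because `3 * m < n` leaves no room for wrapping around
(`exists_isLiftOn_of_near`). They are unique on connected sets because two lifts differ by a
multiple of `n` that can locally change by at most `2 * m` (`IsLiftOn.eqOn`). Subdividing the square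
then lifts paths and homotopies (`exists_isLiftOn_square`), so the endpoint of the lift of a loop,
divided by `n`, is a homotopy invariant, additive under concatenation.

This degree is surjective because integer staircases wind any number of times, and injective because
a loop in the line at `0` is bounded and can be truncated to ever smaller intervals until it is
constant. Both constructions move in unit steps and so need `1 ≤ m`. -/

namespace CechClosure

/-! ### Local lifts, their uniqueness and gluing -/

section Lifting

variable {T : Type*} [TopologicalSpace T] {m n : ℕ}

/-- The closure structure on `ℤ` in which the closure of `k` is `{k - m, …, k + m}`. -/
def line (m : ℕ) : CechClosure ℤ where
  cl := fun A => {y | ∃ k ∈ A, |y - k| ≤ m}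
  cl_empty := by simp
  subset_cl := fun A k hk => ⟨k, hk, by simp⟩
  cl_union := fun A B => by
    ext y
    simp only [mem_union, mem_ofPred_eq, or_and_right, exists_or]

/-- The relation `|y - k| ≤ m` is symmetric, so the closure of `k` is also its smallest
neighborhood. Continuity into the line thereby becomes a local bound on jumps. -/
theorem nhd_line (m : ℕ) (k : ℤ) : (line m).nhd k = 𝓟 {y | |y - k| ≤ m} := by
  ext U
  simp only [mem_nhd, IsNhd, line, mem_compl_iff, mem_ofPred_eq, not_exists, not_and, mem_principal,
    subset_def]
  refine forall_congr' fun y => ?_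
  rw [abs_sub_comm]
  tauto

theorem cont_line_iff {f : T → ℤ} :
    Cont (ofTop T) (line m) f ↔ ∀ t, ∀ᶠ s in 𝓝 t, |f s - f t| ≤ m := by
  simp [cont_ofTop_iff, nhd_line, tendsto_principal]

theorem nhd_cyclic (m n : ℕ) (k : ZMod n) :
    (cyclic m n).nhd k = 𝓟 {y | ∃ j : ℤ, |j| ≤ m ∧ y = k + j} := by
  ext U
  simp only [mem_nhd, IsNhd, cyclic, mem_compl_iff, mem_iUnion, mem_ofPred_eq, mem_principal,
    subset_def, exists_prop, not_exists, not_and]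
  constructor
  · rintro h y ⟨j, hj, rfl⟩
    by_contra hy
    obtain ⟨h1, h2⟩ := abs_le.1 hj
    exact h _ hy (-j) (by omega) (by omega) (by push_cast; ring)
  · rintro h y hy j h1 h2 rfl
    exact hy (h y ⟨-j, abs_le.2 ⟨by omega, by omega⟩, by push_cast; ring⟩)

theorem cont_cyclic_iff {f : T → ZMod n} :
    Cont (ofTop T) (cyclic m n) f ↔
      ∀ t, ∀ᶠ s in 𝓝 t, ∃ j : ℤ, |j| ≤ m ∧ f s = f t + j := by
  simp [cont_ofTop_iff, nhd_cyclic, tendsto_principal]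

theorem Cont.add_intCast {f : T → ℤ} (hf : Cont (ofTop T) (line m) f) (x : ZMod n) :
    Cont (ofTop T) (cyclic m n) (fun t => x + (f t : ZMod n)) := by
  rw [cont_line_iff] at hf
  rw [cont_cyclic_iff]
  exact fun t => (hf t).mono fun s hs => ⟨f s - f t, hs, by push_cast; ring⟩

theorem eq_of_intCast_eq {a b : ℤ} (h : (a : ZMod n) = b) (hab : |a - b| < n) : a = b :=
  sub_eq_zero.1 (Int.eq_zero_of_abs_lt_dvd ((ZMod.intCast_eq_intCast_iff_dvd_sub b a n).1 h.symm) hab)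

/-- `g` is a lift of `F` on `A`, along the map `k ↦ x + k` from the line to the cycle. -/
def IsLiftOn (m : ℕ) (x : ZMod n) (F : T → ZMod n) (A : Set T) (g : T → ℤ) : Prop :=
  (∀ p ∈ A, x + (g p : ZMod n) = F p) ∧ ∀ p ∈ A, ∀ᶠ q in 𝓝[A] p, |g q - g p| ≤ m

variable {x : ZMod n} {F : T → ZMod n} {A B : Set T} {g g' : T → ℤ}

theorem IsLiftOn.mono (h : IsLiftOn m x F B g) (hAB : A ⊆ B) : IsLiftOn m x F A g :=
  ⟨fun p hp => h.1 p (hAB hp), fun p hp => (h.2 p (hAB hp)).filter_mono (nhdsWithin_mono p hAB)⟩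

theorem isLiftOn_univ_iff : IsLiftOn m x F univ g ↔
    (∀ p, x + (g p : ZMod n) = F p) ∧ Cont (ofTop T) (line m) g := by
  simp [IsLiftOn, cont_line_iff]

theorem IsLiftOn.congr (h : IsLiftOn m x F A g) (hg : EqOn g g' A) : IsLiftOn m x F A g' := by
  refine ⟨fun p hp => by rw [← hg hp, h.1 p hp], fun p hp => ?_⟩
  filter_upwards [h.2 p hp, self_mem_nhdsWithin] with q hq hqA
  rwa [← hg hp, ← hg hqA]

theorem IsLiftOn.add_const (h : IsLiftOn m x F A g) {d : ℤ} (hd : (d : ZMod n) = 0) :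
    IsLiftOn m x F A (fun p => g p + d) := by
  refine ⟨fun p hp => by rw [← h.1 p hp]; push_cast; rw [hd, add_zero], fun p hp => ?_⟩
  simpa using h.2 p hp

/-- The difference of two lifts takes values in the multiples of `n` and changes locally by at most
`2 * m < n`. It is therefore locally constant, hence constant on a preconnected set. -/
theorem IsLiftOn.eqOn (hn : 2 * m < n) (hA : IsPreconnected A) (h : IsLiftOn m x F A g)
    (h' : IsLiftOn m x F A g') {p : T} (hp : p ∈ A) (hgp : g p = g' p) : EqOn g g' A := by
  have hc : ContinuousOn (fun q => g q - g' q) A := by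
    intro q hq
    refine tendsto_const_nhds.congr' ?_
    filter_upwards [h.2 q hq, h'.2 q hq, self_mem_nhdsWithin] with r hr hr' hrA
    refine eq_of_intCast_eq (n := n) ?_ ?_
    · have e1 := (h.1 q hq).trans (h'.1 q hq).symm
      have e2 := (h.1 r hrA).trans (h'.1 r hrA).symm
      push_cast
      rw [add_left_cancel e1, add_left_cancel e2, sub_self, sub_self]
    · rw [abs_le] at hr hr'
      rw [abs_lt]
      omega
  intro q hq
  have := hA.constant hc hq hp
  omega

theorem IsLiftOn.union (hA : IsClosed A) (hB : IsClosed B) (h : IsLiftOn m x F A g)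
    (h' : IsLiftOn m x F B g) : IsLiftOn m x F (A ∪ B) g := by
  -- Off the closed set the filter `𝓝[A] p` is trivial, so the jump bound holds at every point and
  -- the two bounds can be joined at any point of the union.
  have key : ∀ {A : Set T}, IsClosed A → IsLiftOn m x F A g →
      ∀ p, ∀ᶠ q in 𝓝[A] p, |g q - g p| ≤ m := by
    intro A hA h p
    by_cases hp : p ∈ A
    · exact h.2 p hp
    · have : 𝓝[A] p = ⊥ := by rwa [← notMem_closure_iff_nhdsWithin_eq_bot, hA.closure_eq]
      simp [this]
  refine ⟨fun p hp => hp.elim (h.1 p) (h'.1 p), fun p _ => ?_⟩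
  rw [nhdsWithin_union, eventually_sup]
  exact ⟨key hA h p, key hB h' p⟩

/-- Shift the second lift by a multiple of `n` so that both agree at one common point. By uniqueness
they then agree on the whole connected overlap. -/
theorem exists_isLiftOn_union (hn : 2 * m < n) (hA : IsClosed A) (hB : IsClosed B)
    (hAB : IsPreconnected (A ∩ B)) (hne : (A ∩ B).Nonempty) (h : ∃ g, IsLiftOn m x F A g)
    (h' : ∃ g, IsLiftOn m x F B g) : ∃ g, IsLiftOn m x F (A ∪ B) g := by
  classical
  obtain ⟨g, hg⟩ := h
  obtain ⟨g', hg'⟩ := h'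
  obtain ⟨p, hpA, hpB⟩ := hne
  have hd : ((g p - g' p : ℤ) : ZMod n) = 0 := by
    push_cast
    rw [add_left_cancel ((hg.1 p hpA).trans (hg'.1 p hpB).symm), sub_self]
  have hs := hg'.add_const hd
  have heq : EqOn g (fun q => g' q + (g p - g' p)) (A ∩ B) :=
    (hg.mono inter_subset_left).eqOn hn hAB (hs.mono inter_subset_right) ⟨hpA, hpB⟩ (by simp)
  refine ⟨A.piecewise g (fun q => g' q + (g p - g' p)), IsLiftOn.union hA hB
    (hg.congr (A.piecewise_eqOn _ _).symm) (hs.congr fun q hq => ?_)⟩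
  by_cases hqA : q ∈ A
  · rw [piecewise_eq_of_mem _ _ _ hqA, heq ⟨hqA, hq⟩]
  · rw [piecewise_eq_of_notMem _ _ _ hqA]

theorem exists_isLiftOn_of_near (hn : 3 * m < n) (hF : Cont (ofTop T) (cyclic m n) F) (p : T)
    (hA : ∀ q ∈ A, ∃ j : ℤ, |j| ≤ m ∧ F q = F p + j) : ∃ g, IsLiftOn m x F A g := by
  obtain ⟨a, ha⟩ := ZMod.intCast_surjective (F p - x)
  choose! j hj hFj using hA
  rw [cont_cyclic_iff] at hF
  refine ⟨fun q => a + j q, fun q hq => ?_, fun q hq => ?_⟩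
  · rw [hFj q hq]
    push_cast
    rw [ha]
    ring
  · filter_upwards [mem_nhdsWithin_of_mem_nhds (hF q), self_mem_nhdsWithin] with r hr hrA
    obtain ⟨i, hi, hri⟩ := hr
    have h1 := hj q hq
    have h2 := hj r hrA
    have e : j r = j q + i := by
      -- Three displacements of size at most `m` occur here. This is the one estimate that needs `3
      -- * m < n` and not merely `2 * m < n`.
      refine eq_of_intCast_eq (n := n) ?_ ?_
      · rw [hFj q hq, hFj r hrA, add_assoc] at hri
        push_cast
        exact add_left_cancel hri
      · rw [abs_le] at h1 h2 hi
        rw [abs_lt]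
        omega
    have : a + j r - (a + j q) = i := by omega
    rwa [this]

end Lifting

/-! ### Lifting paths and homotopies; paths in the line -/

section Square

variable {m n : ℕ} {x : ZMod n}

/-- A fine grid has each cell inside a set where `F` stays within `m` of one value, so each cell has
a lift. Cells are glued into strips and strips into the square; each new piece meets the previous
ones in a segment, which is connected. -/
theorem exists_isLiftOn_square (hn : 3 * m < n) {F : I × I → ZMod n}
    (hF : Cont (ofTop (I × I)) (cyclic m n) F) : ∃ g, IsLiftOn m x F univ g := by
  have hF' := cont_cyclic_iff.1 hF
  choose U hU hUo hpU using fun p => mem_nhds_iff.1 (hF' p)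
  obtain ⟨t, ht0, htm, ⟨N, hN⟩, hts⟩ := exists_monotone_Icc_subset_open_cover_unitInterval_prod_self
    hUo (fun p _ => mem_iUnion.2 ⟨p, hpU p⟩)
  have hcell : ∀ k l, ∃ g, IsLiftOn m x F (Icc (t k) (t (k + 1)) ×ˢ Icc (t l) (t (l + 1))) g := by
    intro k l
    obtain ⟨p, hp⟩ := hts k l
    exact exists_isLiftOn_of_near hn hF p fun q hq => hU p (hp hq)
  have hstrip : ∀ l k, ∃ g, IsLiftOn m x F (Icc 0 (t k) ×ˢ Icc (t l) (t (l + 1))) g := by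
    intro l k
    induction k with
    | zero =>
      obtain ⟨g, hg⟩ := hcell 0 l
      refine ⟨g, hg.mono (prod_mono ?_ subset_rfl)⟩
      -- Since `t 0 = 0`, the initial rectangle is degenerate and lies in the first cell.
      rw [ht0]
      exact Icc_subset_Icc_right bot_le
    | succ k ih =>
      have hk := htm (Nat.le_succ k)
      have hl := htm (Nat.le_succ l)
      have h0 : (0 : I) ≤ t k := bot_le
      have hint : Icc 0 (t k) ×ˢ Icc (t l) (t (l + 1)) ∩
          Icc (t k) (t (k + 1)) ×ˢ Icc (t l) (t (l + 1)) = {t k} ×ˢ Icc (t l) (t (l + 1)) := by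
        rw [← inter_prod, Icc_inter_Icc_eq_singleton h0 hk]
      have := exists_isLiftOn_union (by omega) (isClosed_Icc.prod isClosed_Icc)
        (isClosed_Icc.prod isClosed_Icc) (by
          rw [hint]; exact isPreconnected_singleton.prod isPreconnected_Icc)
        (by rw [hint]; exact (singleton_nonempty _).prod (nonempty_Icc.2 hl)) ih (hcell k l)
      rwa [← union_prod, Icc_union_Icc_eq_Icc h0 hk] at this
  have hstrip' : ∀ l, ∃ g, IsLiftOn m x F (univ ×ˢ Icc (t l) (t (l + 1))) g := by
    intro l
    obtain ⟨g, hg⟩ := hstrip l N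
    refine ⟨g, hg.mono (prod_mono ?_ subset_rfl)⟩
    rw [hN N le_rfl]
    exact fun s _ => ⟨bot_le, le_top⟩
  have hrect : ∀ l, ∃ g, IsLiftOn m x F (univ ×ˢ Icc 0 (t l)) g := by
    intro l
    induction l with
    | zero =>
      obtain ⟨g, hg⟩ := hstrip' 0
      refine ⟨g, hg.mono (prod_mono subset_rfl ?_)⟩
      rw [ht0]
      exact Icc_subset_Icc_right bot_le
    | succ l ih =>
      have hl := htm (Nat.le_succ l)
      have h0 : (0 : I) ≤ t l := bot_le
      have hint : (univ : Set I) ×ˢ Icc 0 (t l) ∩ univ ×ˢ Icc (t l) (t (l + 1)) =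
          univ ×ˢ {t l} := by
        rw [← prod_inter, Icc_inter_Icc_eq_singleton h0 hl]
      have := exists_isLiftOn_union (by omega) (isClosed_univ.prod isClosed_Icc)
        (isClosed_univ.prod isClosed_Icc) (by
          rw [hint]; exact isPreconnected_univ.prod isPreconnected_singleton)
        (by rw [hint]; exact univ_nonempty.prod (singleton_nonempty _)) ih (hstrip' l)
      rwa [← prod_union, Icc_union_Icc_eq_Icc h0 hl] at this
  obtain ⟨g, hg⟩ := hrect N
  refine ⟨g, hg.mono ?_⟩
  rw [hN N le_rfl]
  exact fun s _ => ⟨mem_univ _, bot_le, le_top⟩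

theorem exists_lift_square (hn : 3 * m < n) {F : I × I → ZMod n}
    (hF : Cont (ofTop (I × I)) (cyclic m n) F) (h0 : F (0, 0) = x) :
    ∃ g, IsLiftOn m x F univ g ∧ g (0, 0) = 0 := by
  obtain ⟨g, hg⟩ := exists_isLiftOn_square (x := x) hn hF
  refine ⟨_, hg.add_const (d := -g (0, 0)) ?_, by simp⟩
  have := hg.1 (0, 0) (mem_univ _)
  rw [h0] at this
  push_cast
  rw [neg_eq_zero]
  exact left_eq_add.1 this.symm

theorem IsLiftOn.comp {S T : Type*} [TopologicalSpace S] [TopologicalSpace T] {F : T → ZMod n}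
    {g : T → ℤ} (h : IsLiftOn m x F univ g) {φ : S → T} (hφ : Continuous φ) :
    IsLiftOn m x (fun s => F (φ s)) univ (fun s => g (φ s)) := by
  rw [isLiftOn_univ_iff] at h ⊢
  exact ⟨fun s => h.1 _, h.2.comp_continuous hφ⟩

theorem exists_lift_path (hn : 3 * m < n) {F : I → ZMod n}
    (hF : Cont (ofTop I) (cyclic m n) F) (h0 : F 0 = x) :
    ∃ g, IsLiftOn m x F univ g ∧ g 0 = 0 := by
  -- A path is lifted as a map on the square that ignores the second coordinate.
  obtain ⟨g, hg, hg0⟩ := exists_lift_square (F := fun p => F p.1) hn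
    (hF.comp_continuous continuous_fst) h0
  exact ⟨fun s => g (s, 0), hg.comp (by fun_prop : Continuous fun s : I => (s, (0 : I))), hg0⟩

theorem IsLiftOn.ext_path (hn : 2 * m < n) {F : I → ZMod n} {g g' : I → ℤ}
    (h : IsLiftOn m x F univ g) (h' : IsLiftOn m x F univ g') (h0 : g 0 = g' 0) : g = g' :=
  funext fun s => h.eqOn hn isPreconnected_univ h' (mem_univ 0) h0 (mem_univ s)

/-- The second lift must start where the first ends. The shift by `g 1` keeps it a lift because `g
1` is a multiple of `n`. -/
theorem isLiftOn_star {F F' : I → ZMod n} {g g' : I → ℤ} (h : IsLiftOn m x F univ g)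
    (h' : IsLiftOn m x F' univ g') (h0 : g' 0 = 0) (h1 : (g 1 : ZMod n) = 0) :
    IsLiftOn m x (star F F') univ (star g (fun s => g' s + g 1)) := by
  have hs := h'.add_const h1
  rw [isLiftOn_univ_iff] at h hs ⊢
  refine ⟨fun s => ?_, cont_star h.2 hs.2 (by simp [h0])⟩
  unfold star
  split_ifs
  · exact h.1 _
  · exact hs.1 _

/-- The floor of a continuous function jumps by at most `1` locally, which is where `1 ≤ m` enters.
These staircases provide both the loops of given degree and the shrinking bound in the
null-homotopy. -/
theorem cont_floor_mul (hm : 1 ≤ m) (r : ℝ) :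
    Cont (ofTop I) (line m) (fun s => ⌊r * (s : ℝ)⌋) := by
  rw [cont_line_iff]
  intro s
  have hc : Continuous fun s : I => r * (s : ℝ) := by fun_prop
  have h1 : (⌊r * (s : ℝ)⌋ : ℝ) - 1 < r * (s : ℝ) := by linarith [Int.floor_le (r * (s : ℝ))]
  filter_upwards [hc.continuousAt.eventually (lt_mem_nhds h1),
    hc.continuousAt.eventually (gt_mem_nhds (Int.lt_floor_add_one (r * (s : ℝ))))] with t ht ht'
  have e1 : ⌊r * (s : ℝ)⌋ - 1 ≤ ⌊r * (t : ℝ)⌋ := Int.le_floor.2 (by push_cast; exact ht.le)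
  have e2 : ⌊r * (t : ℝ)⌋ < ⌊r * (s : ℝ)⌋ + 1 := Int.floor_lt.2 (by push_cast; exact ht')
  rw [abs_le]
  omega

/-- The map is locally bounded by the jump condition, hence bounded by compactness. -/
theorem Cont.exists_abs_le {T : Type*} [TopologicalSpace T] [CompactSpace T] {g : T → ℤ}
    (hg : Cont (ofTop T) (line m) g) : ∃ N : ℕ, ∀ s, |g s| ≤ N := by
  rw [cont_line_iff] at hg
  have := isCompact_univ.induction_on (p := fun S : Set T => ∃ N : ℕ, ∀ s ∈ S, |g s| ≤ N)
    ⟨0, by simp⟩ (fun S S' hS ⟨N, hN⟩ => ⟨N, fun s hs => hN s (hS hs)⟩)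
    (fun S S' ⟨N, hN⟩ ⟨N', hN'⟩ => ⟨max N N', fun s hs => ?_⟩)
    (fun t _ => ⟨_, mem_nhdsWithin_of_mem_nhds (hg t), m + (g t).natAbs, fun s hs => ?_⟩)
  · obtain ⟨N, hN⟩ := this
    exact ⟨N, fun s => hN s (mem_univ s)⟩
  · rcases hs with hs | hs
    · exact (hN s hs).trans (by simp)
    · exact (hN' s hs).trans (by simp)
  · have h : |g s - g t| ≤ m := hs
    rw [abs_le] at h ⊢
    omega

end Square

/-! ### The degree of a loop -/

namespace Loop

variable {m n : ℕ} {x : ZMod n}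

theorem exists_lift (hn : 3 * m < n) (v : Loop (cyclic m n) x) :
    ∃ g : I → ℤ, IsLiftOn m x v.toFun univ g ∧ g 0 = 0 :=
  exists_lift_path hn v.cont v.source

/-- The lift of a loop to a path in the line that starts at `0`. -/
noncomputable def lift (hn : 3 * m < n) (v : Loop (cyclic m n) x) : I → ℤ :=
  (v.exists_lift hn).choose

theorem isLiftOn_lift (hn : 3 * m < n) (v : Loop (cyclic m n) x) :
    IsLiftOn m x v.toFun univ (v.lift hn) := (v.exists_lift hn).choose_spec.1

@[simp] theorem lift_zero (hn : 3 * m < n) (v : Loop (cyclic m n) x) : v.lift hn 0 = 0 :=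
  (v.exists_lift hn).choose_spec.2

theorem intCast_lift_one (hn : 3 * m < n) (v : Loop (cyclic m n) x) :
    (v.lift hn 1 : ZMod n) = 0 := by
  have := (v.isLiftOn_lift hn).1 1 (mem_univ _)
  rw [v.target] at this
  exact left_eq_add.1 this.symm

/-- The winding number of a loop in the cycle. -/
noncomputable def degree (hn : 3 * m < n) (v : Loop (cyclic m n) x) : ℤ := v.lift hn 1 / n

/-- The lift of a loop ends at a multiple of `n`, so the integer division defining the degree is
exact. -/
theorem mul_degree (hn : 3 * m < n) (v : Loop (cyclic m n) x) :
    n * v.degree hn = v.lift hn 1 :=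
  Int.mul_ediv_cancel' ((ZMod.intCast_zmod_eq_zero_iff_dvd _ n).1 (v.intCast_lift_one hn))

theorem lift_eq (hn : 3 * m < n) (v : Loop (cyclic m n) x) {g : I → ℤ}
    (hg : IsLiftOn m x v.toFun univ g) (h0 : g 0 = 0) : v.lift hn = g :=
  (v.isLiftOn_lift hn).ext_path (by omega) hg (by rw [lift_zero, h0])

theorem degree_eq (hn : 3 * m < n) (v : Loop (cyclic m n) x) {g : I → ℤ} {k : ℤ}
    (hg : IsLiftOn m x v.toFun univ g) (h0 : g 0 = 0) (h1 : g 1 = n * k) :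
    v.degree hn = k := by
  have := v.mul_degree hn
  rw [v.lift_eq hn hg h0, h1] at this
  exact mul_left_cancel₀ (by omega) this

theorem degree_mul (hn : 3 * m < n) (v w : Loop (cyclic m n) x) :
    (v.mul w).degree hn = v.degree hn + w.degree hn := by
  refine degree_eq hn _ (isLiftOn_star (v.isLiftOn_lift hn) (w.isLiftOn_lift hn) (w.lift_zero hn)
    (v.intCast_lift_one hn)) (by simp) ?_
  rw [star_one, ← mul_degree, ← mul_degree]
  ring

/-- Lift the whole homotopy. Its two vertical sides lift constant paths, so by uniqueness they are
constant; the bottom and top lifts thus share both endpoints. -/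
theorem Homotopic.degree_eq (hn : 3 * m < n) {v w : Loop (cyclic m n) x} (h : v.Homotopic w) :
    v.degree hn = w.degree hn := by
  obtain ⟨H, hH, h0, h1, h2⟩ := homotopic_iff.1 h
  obtain ⟨G, hG, hG0⟩ := exists_lift_square hn hH (h2 0).1
  have hn' : 2 * m < n := by omega
  have side : ∀ s : I, (∀ t, H (s, t) = x) → ∀ t, G (s, t) = G (s, 0) := by
    intro s hs t
    have hl := hG.comp (by fun_prop : Continuous fun t : I => (s, t))
    have hconst : IsLiftOn m x (fun t => H (s, t)) univ (fun _ => G (s, 0)) := by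
      refine ⟨fun t _ => ?_, fun t _ => by simp⟩
      exact (hG.1 _ (mem_univ _)).trans ((hs 0).trans (hs t).symm)
    exact congrFun (hl.ext_path hn' hconst rfl) t
  have hv : v.lift hn = fun s => G (s, 0) := by
    refine v.lift_eq hn ?_ hG0
    simpa only [h0] using hG.comp (by fun_prop : Continuous fun s : I => (s, (0 : I)))
  have hw : w.lift hn = fun s => G (s, 1) := by
    refine w.lift_eq hn ?_ ((side 0 (fun t => (h2 t).1) 1).trans hG0)
    simpa only [h1] using hG.comp (by fun_prop : Continuous fun s : I => (s, (1 : I)))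
  unfold degree
  rw [hv, hw]
  exact congrArg (· / (n : ℤ)) (side 1 (fun t => (h2 t).2) 1).symm

/-- The lift is a bounded loop at `0` in the line. Truncating it to intervals around `0` that shrink
to a point contracts it, and the contraction is projected to the cycle. -/
theorem homotopic_one_of_degree_eq_zero (hm : 1 ≤ m) (hn : 3 * m < n)
    {v : Loop (cyclic m n) x} (h : v.degree hn = 0) : v.Homotopic (one _ x) := by
  have hl := isLiftOn_univ_iff.1 (v.isLiftOn_lift hn)
  have hl0 := v.lift_zero hn
  have hl1 := v.mul_degree hn
  rw [h, mul_zero] at hl1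
  generalize v.lift hn = g at hl hl0 hl1
  obtain ⟨N, hN⟩ := hl.2.exists_abs_le
  obtain ⟨c, hc, hc0, hc1⟩ : ∃ c : I → ℤ, Cont (ofTop I) (line m) c ∧ c 0 = N ∧ c 1 = 0 :=
    ⟨fun t => ⌊(N : ℝ) * (σ t : ℝ)⌋,
      (cont_floor_mul hm N).comp_continuous unitInterval.continuous_symm, by simp, by simp⟩
  -- Truncation changes by at most the larger of the changes of `g` and `c`, so joint jumps stay
  -- within `m`. The absolute value makes `-|c| ≤ |c|` automatic.
  have hH : Cont (ofTop (I × I)) (line m) fun p => max (min (g p.1) |c p.2|) (-|c p.2|) := by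
    have hg' := cont_line_iff.1 (hl.2.comp_continuous (continuous_fst (Y := I)))
    have hc' := cont_line_iff.1 (hc.comp_continuous (continuous_snd (X := I)))
    rw [cont_line_iff]
    intro p
    filter_upwards [hg' p, hc' p] with q hq hq'
    replace hq' := (abs_abs_sub_abs_le (c q.2) (c p.2)).trans hq'
    rw [abs_le] at hq hq' ⊢
    omega
  refine homotopic_iff.2 ⟨_, hH.add_intCast x, fun s => ?_, fun s => ?_, fun t => ?_⟩
  · obtain ⟨h1, h2⟩ := abs_le.1 (hN s)
    rw [← hl.1 s]
    simp [hc0, h1, h2]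
  · simp [hc1, one]
  · simp [hl0, ← hl1]

theorem exists_degree_eq (hm : 1 ≤ m) (hn : 3 * m < n) (k : ℤ) :
    ∃ v : Loop (cyclic m n) x, v.degree hn = k := by
  -- The staircase from `0` to `n * k` projects to a loop that winds `k` times.
  have hc := cont_floor_mul hm ((n * k : ℤ) : ℝ)
  have e1 : ⌊((n * k : ℤ) : ℝ) * ((1 : I) : ℝ)⌋ = n * k := by
    rw [Icc.coe_one, mul_one, Int.floor_intCast]
  refine ⟨⟨_, hc.add_intCast x, by simp, by rw [e1]; simp⟩, ?_⟩
  exact degree_eq hn _ (isLiftOn_univ_iff.2 ⟨fun s => rfl, hc⟩) (by simp) e1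

end Loop

/-! ### The degree isomorphism -/

namespace FundamentalGroup

variable {m n : ℕ}

/-- The winding number, as a homomorphism on the fundamental group of the cycle. -/
noncomputable def degreeHom (hn : 3 * m < n) (x : ZMod n) :
    FundamentalGroup (cyclic m n) x →* Multiplicative ℤ :=
  MonoidHom.mk' (Quotient.lift (fun v => Multiplicative.ofAdd (v.degree hn))
    fun _ _ h => congrArg Multiplicative.ofAdd (Loop.Homotopic.degree_eq hn h)) (by
      rintro ⟨v⟩ ⟨w⟩
      exact congrArg Multiplicative.ofAdd (Loop.degree_mul hn v w))

theorem degreeHom_bijective (hm : 1 ≤ m) (hn : 3 * m < n) (x : ZMod n) :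
    Function.Bijective (degreeHom hn x) := by
  constructor
  · rw [injective_iff_map_eq_one]
    rintro ⟨v⟩ hv
    exact Quotient.sound
      (Loop.homotopic_one_of_degree_eq_zero hm hn (Multiplicative.ofAdd.injective hv))
  · intro k
    obtain ⟨v, hv⟩ := Loop.exists_degree_eq (x := x) hm hn k.toAdd
    exact ⟨Quotient.mk _ v, congrArg Multiplicative.ofAdd hv⟩

end FundamentalGroup

end CechClosure

theorem mainTheorem5 (m n : ℕ) (hm : 3 ≤ 3 * m) (hn : 3 * m < n) (x : ZMod n) :
    Nonempty (CechClosure.FundamentalGroup (CechClosure.cyclic m n) x ≃* Multiplicative ℤ) :=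
  ⟨MulEquiv.ofBijective _ (CechClosure.FundamentalGroup.degreeHom_bijective (by omega) hn x)⟩
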